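/- For $x\in\mathbb C$ and an integer $n\ge 0$ let $(x)_n=x(x+1)\cdots(x+n-1)$ (with $(x)_0=1$), and for $k\in\mathbb C$ let $(x)_k=\Gamma(x+k)/\Gamma(x)$, where $1/\Gamma$ is read as $0$ at the poles of $\Gamma$. Put $$C(n,k)=\frac{\left(\frac12-k\right)_n\left(\frac12+k\right)_n\left(\frac16+k\right)_n\left(\frac56+k\right)_n}{\left(\frac12+\frac k2\right)_n\left(1+\frac k2\right)_n(1+k)_n(1)_n},\qquad R(n,k)=\frac{(154n+15)(2n+1)+k(352n+108k+108)}{2n+k+1},$$ $$B(n,k)=C(n,k)\,\frac{\left(\frac16\right)_k\left(\frac56\right)_k}{(1)_k^2}.$$ (1) For every $k\in\mathbb C$ that is not a negative integer, the following series converges absolutely and $$\sum_{n=0}^{\infty}\left(\frac{-27}{512}\right)^n C(n,k)\,R(n,k)=\frac{32\sqrt2}{\pi}\left(\frac{32}{27}\right)^k\frac{(1)_k^2}{\left(\frac16\right)_k\left(\frac56\right)_k}.$$ (2) This generalizes the Ramanujan series with $s=\frac16$, $z=-\frac{27}{512}$, $a=15$, $b=154$ (the case $k=0$): $$\sum_{n=0}^{\infty}\left(\frac{-27}{512}\right)^n\frac{\left(\frac12\right)_n\left(\frac16\right)_n\left(\frac56\right)_n}{(1)_n^3}(154n+15)=\frac{32\sqrt2}{\pi}.$$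 (3) The generalization is WZ-demonstrable: there are rational numbers $e_{10},e_{01},e_{00}$ such that $$G(n,k)=\left(\frac{-27}{512}\right)^n\left(\frac{27}{32}\right)^kB(n,k)R(n,k),\qquad F(n,k)=\left(\frac{-27}{512}\right)^n\left(\frac{27}{32}\right)^kB(n,k)\,\frac{n(e_{10}n+e_{01}k+e_{00})}{2n-2k-1}$$ form a WZ-pair, that is, both are hypergeometric in $n$ and in $k$ (the quotients $A(n+1,k)/A(n,k)$ and $A(n,k+1)/A(n,k)$ are rational functions of $n$ and $k$) and $$F(n+1,k)-F(n,k)=G(n,k+1)-G(n,k);$$ moreover $F(0,k)=0$ and $\lim_{n\to\infty}F(n,k)=0$. Here $n\ge0$ is an integer and $k\in\mathbb C$ avoids the negative integers, the numbers $-\frac16-m$ and $-\frac56-m$ ($m=0,1,2,\dots$), and the half-odd integers, where factors of $F$ or $G$ may be singular. -/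

import Mathlib

namespace RamanujanWZ

/-- The rising factorial `(x)_n = x (x + 1) ⋯ (x + n - 1)` for a natural number `n`. -/
noncomputable def rising (x : ℂ) (n : ℕ) : ℂ :=
  (ascPochhammer ℂ n).eval x

/-- The Pochhammer symbol `(x)_k = Γ(x + k) / Γ(x)` for a complex index `k`. -/
noncomputable def poch (x k : ℂ) : ℂ :=
  Complex.Gamma (x + k) / Complex.Gamma x

/-- `(1/2 - k)_n (1/2 + k)_n (1/6 + k)_n (5/6 + k)_n / ((1/2 + k/2)_n (1 + k/2)_n (1 + k)_n (1)_n)`. -/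
noncomputable def coeffC (n : ℕ) (k : ℂ) : ℂ :=
  (rising (1 / 2 - k) n * rising (1 / 2 + k) n * rising (1 / 6 + k) n * rising (5 / 6 + k) n) /
    (rising (1 / 2 + k / 2) n * rising (1 + k / 2) n * rising (1 + k) n * rising 1 n)

/-- `(1/6)_k (5/6)_k / (1)_k ^ 2`. -/
noncomputable def factorD (k : ℂ) : ℂ :=
  (poch (1 / 6) k * poch (5 / 6) k) / poch 1 k ^ 2

/-- The rational factor `((154 n + 15)(2 n + 1) + k (352 n + 108 k + 108)) / (2 n + k + 1)`. -/
noncomputable def ratR (n : ℕ) (k : ℂ) : ℂ :=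
  ((154 * n + 15) * (2 * n + 1) + k * (352 * n + 108 * k + 108)) / (2 * n + k + 1)

/-- `A` is hypergeometric in its two variables (with `k` running over `U`): the quotients
`A(n+1,k)/A(n,k)` and `A(n,k+1)/A(n,k)` are rational functions of `n` and `k`. The quotients are
cross-multiplied, so that nothing is divided by zero. -/
def IsHypergeometricOn (U : Set ℂ) (A : ℕ → ℂ → ℂ) : Prop :=
  (∃ p q : MvPolynomial (Fin 2) ℂ, q ≠ 0 ∧ ∀ n : ℕ, ∀ k ∈ U,
      MvPolynomial.eval ![(n : ℂ), k] q * A (n + 1) k =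
        MvPolynomial.eval ![(n : ℂ), k] p * A n k) ∧
  (∃ p q : MvPolynomial (Fin 2) ℂ, q ≠ 0 ∧ ∀ n : ℕ, ∀ k ∈ U,
      MvPolynomial.eval ![(n : ℂ), k] q * A n (k + 1) =
        MvPolynomial.eval ![(n : ℂ), k] p * A n k)

/-- `(F, G)` is a Wilf–Zeilberger pair (with `k` running over `U`). -/
structure IsWZPairOn (U : Set ℂ) (F G : ℕ → ℂ → ℂ) : Prop where
  hypergeometric_left : IsHypergeometricOn U F
  hypergeometric_right : IsHypergeometricOn U G
  wz : ∀ n : ℕ, ∀ k ∈ U, F (n + 1) k - F n k = G n (k + 1) - G n k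

/-- The complex numbers `k` that are no singularity of any factor of the pair: not a pole of
`coeffC`, `ratR` or `factorD` (negative integers and `-1/6 - m`, `-5/6 - m` with `m ≥ 0`), and not
half an odd integer, where the denominator `2 n - 2 k - 1` may vanish. It is closed under
`k ↦ k + 1`. -/
def regularSet : Set ℂ :=
  {k | (∀ m : ℕ, k ≠ -(m + 1) ∧ k ≠ -(1 / 6 + m) ∧ k ≠ -(5 / 6 + m)) ∧
    ∀ m : ℤ, k ≠ m + 1 / 2}

end RamanujanWZ

namespace RamanujanWZ

open Filter Topology Function.Periodic MvPolynomial

/-! Write `S k` for `∑' n, term n k`. A WZ certificate shows that `shiftFactor k * term n (k + 1) -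
term n k` is the difference in `n` of `cert`. Since `cert n k` tends to 0, summation gives
`shiftFactor k * S (k + 1) = S k`, and as `weight (k + 1) = shiftFactor k * weight k`, the product
`weight k * S k` has period 1 on the right half-plane.

Periodicity alone does not make it constant; a Carlson-type argument does. For `0 ≤ k.re` the terms
are dominated by a binomial series, so `S` grows at most exponentially in `‖k‖`, while `weight` is
bounded for `1 ≤ k.re` because `factorD` is a product of two Beta integrals. On the strip `1 ≤ k.re
≤ 2` the product is therefore at most a constant times `exp (2 * |k.im|)`. A periodic function of
exponential type below `2π` is, as a function of `q = exp (2πik)`, regular at 0 and of sublinear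
growth at infinity, hence constant by Liouville (`eq_of_periodic_halfPlane`).

The constant is read off at `k = 1/2`, where the factor `(1/2 - k)_n` kills every term but the
first. The functional equation then carries the closed form leftwards to every `k` that is not a
negative integer. The WZ pair is the same certificate multiplied by `weight`. -/

/-! ### Pochhammer symbols, the coefficients and their nonvanishing denominators. -/

theorem rising_zero (x : ℂ) : rising x 0 = 1 := by
  simp [rising]

theorem rising_succ (x : ℂ) (n : ℕ) : rising x (n + 1) = rising x n * (x + n) := by
  simp [rising, ascPochhammer_succ_right]

theorem rising_succ_left (x : ℂ) (n : ℕ) : rising x (n + 1) = x * rising (x + 1) n := by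
  simp [rising, ascPochhammer_succ_left, Polynomial.eval_comp]

theorem rising_ne_zero {x : ℂ} (hx : ∀ m : ℕ, x + m ≠ 0) (n : ℕ) : rising x n ≠ 0 := by
  induction n with
  | zero => simp [rising_zero]
  | succ n ih => rw [rising_succ]; exact mul_ne_zero ih (hx n)

theorem coeffC_zero (k : ℂ) : coeffC 0 k = 1 := by
  simp [coeffC, rising_zero]

theorem coeffC_succ (n : ℕ) (k : ℂ) :
    coeffC (n + 1) k = coeffC n k *
      (((1 / 2 - k + n) * (1 / 2 + k + n) * (1 / 6 + k + n) * (5 / 6 + k + n)) /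
        ((1 / 2 + k / 2 + n) * (1 + k / 2 + n) * (1 + k + n) * (1 + n))) := by
  simp only [coeffC, rising_succ, div_mul_div_comm]
  congr 1 <;> ring

section Nonsingular

variable {k : ℂ} (hk : ∀ m : ℕ, k ≠ -(m + 1))
include hk

theorem one_add_add_natCast_ne_zero (m : ℕ) : 1 + k + m ≠ 0 := fun h =>
  hk m (by linear_combination h)

theorem one_add_half_add_natCast_ne_zero (m : ℕ) : 1 + k / 2 + m ≠ 0 := fun h =>
  hk (2 * m + 1) (by push_cast; linear_combination 2 * h)

theorem half_add_half_add_natCast_ne_zero (m : ℕ) : 1 / 2 + k / 2 + m ≠ 0 := fun h =>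
  hk (2 * m) (by push_cast; linear_combination 2 * h)

theorem two_mul_natCast_add_add_one_ne_zero (m : ℕ) : 2 * m + k + 1 ≠ 0 := fun h =>
  hk (2 * m) (by push_cast; linear_combination h)

theorem ne_neg_of_add_one (m : ℕ) : k + 1 ≠ -(m + 1) := fun h =>
  hk (m + 1) (by push_cast; linear_combination h)

end Nonsingular

theorem one_add_natCast_ne_zero (m : ℕ) : (1 : ℂ) + m ≠ 0 := by
  rw [add_comm]; exact Nat.cast_add_one_ne_zero m

/-! ### The WZ certificate and its telescoping identity. -/

/-- The quotient `factorD (k + 1) / factorD k` times `27 / 32`. -/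
noncomputable def shiftFactor (k : ℂ) : ℂ :=
  27 / 32 * ((1 / 6 + k) * (5 / 6 + k)) / (1 + k) ^ 2

/-- The cancellation needed in `shiftFactor_mul_coeffC`, with Pochhammer symbols and linear factors
replaced by free variables; `s₆` plays the role of `1 + k`. -/
theorem shift_algebra {r₀ r₁ r₂ r₃ r₄ r₅ r₆ r₇ s₀ s₁ s₂ s₃ s₄ s₅ s₆ t₄ u₄ t₅ u₅ t₆ u₆ : ℂ}
    (hs₆ : s₆ ≠ 0) (hr₀ : r₀ ≠ 0) (hr₁ : r₁ ≠ 0) (hr₂ : r₂ ≠ 0) (hr₃ : r₃ ≠ 0) (hs₀ : s₀ ≠ 0)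
    (hs₂ : s₂ ≠ 0) (hs₃ : s₃ ≠ 0) (hs₅ : s₅ ≠ 0) (hs₄ : s₄ ≠ 0) (hs₁ : s₁ ≠ 0) :
    -(27 / 32) * (r₇ * (r₄ * t₄ * u₄) * (r₅ * t₅ * u₅) * (r₆ * t₆ * u₆)) /
      (s₆ ^ 2 * (r₁ * s₂ * (r₀ * s₀ * s₁ / (s₆ / 2)) * (r₂ * s₃ * s₄ / s₆) * (r₃ * s₅))) =
    r₇ * r₄ * r₅ * r₆ / (r₀ * r₁ * r₂ * r₃) * (-(27 / 64) *
      (t₄ * u₄ * t₅ * u₅ * t₆ * u₆) / (s₀ * s₁ * s₂ * s₃ * s₄ * s₅)) := by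
  field_simp
  ring

/-- Raising `n` together with `k` turns `(1/2 - (k + 1))_{n+1}` into `-(1/2 + k) (1/2 - k)_n`, so no
factor `n - 1/2 - k` enters a denominator and half-odd `k` need not be excluded. This matters
because the series is evaluated at `k = 1/2`. The factors `1/2 + k`, `1/6 + k`, `5/6 + k` are
absorbed by `x (x + 1)_{n+1} = (x)_{n+2}`. -/
theorem shiftFactor_mul_coeffC {k : ℂ} (hk : ∀ m : ℕ, k ≠ -(m + 1)) (n : ℕ) :
    shiftFactor k * coeffC (n + 1) (k + 1) = coeffC n k * (-(27 / 64) *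
      ((1 / 2 + k + n) * (3 / 2 + k + n) * (1 / 6 + k + n) * (7 / 6 + k + n) *
        (5 / 6 + k + n) * (11 / 6 + k + n)) /
      ((1 / 2 + k / 2 + n) * (3 / 2 + k / 2 + n) * (1 + k / 2 + n) * (1 + k + n) * (2 + k + n) *
        (1 + n))) := by
  have e1 : rising (1 / 2 - (k + 1)) (n + 1) = -(1 / 2 + k) * rising (1 / 2 - k) n := by
    rw [rising_succ_left, show 1 / 2 - (k + 1) + 1 = 1 / 2 - k by ring]; ring
  have two (x : ℂ) : x * rising (x + 1) (n + 1) = rising x n * (x + n) * (x + 1 + n) := by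
    rw [← rising_succ_left, rising_succ, rising_succ]; push_cast; ring
  have e2 := two (1 / 2 + k)
  have e3 := two (1 / 6 + k)
  have e4 := two (5 / 6 + k)
  have e5 := two (1 / 2 + k / 2)
  have e6 := two (1 + k)
  have e7 : rising (1 / 2 + (k + 1) / 2) (n + 1) = rising (1 + k / 2) n * (1 + k / 2 + n) := by
    rw [show 1 / 2 + (k + 1) / 2 = 1 + k / 2 by ring, rising_succ]
  have e8 := rising_succ 1 n
  have h0 := half_add_half_add_natCast_ne_zero hk
  have h1 := one_add_half_add_natCast_ne_zero hk
  have h2 := one_add_add_natCast_ne_zero hk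
  have a0 : (1 / 2 + k / 2 : ℂ) ≠ 0 := by simpa using h0 0
  have a1 : (1 + k : ℂ) ≠ 0 := by simpa using h2 0
  have f5 : rising (1 / 2 + k / 2 + 1) (n + 1) =
      rising (1 / 2 + k / 2) n * (1 / 2 + k / 2 + n) * (1 / 2 + k / 2 + 1 + n) /
        (1 / 2 + k / 2) := by
    rw [eq_div_iff a0, ← e5]; ring
  have f6 : rising (1 + k + 1) (n + 1) =
      rising (1 + k) n * (1 + k + n) * (1 + k + 1 + n) / (1 + k) := by
    rw [eq_div_iff a1, ← e6]; ring
  have b0 := rising_ne_zero h0 n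
  have b1 := rising_ne_zero h1 n
  have b2 := rising_ne_zero h2 n
  have b3 := rising_ne_zero one_add_natCast_ne_zero n
  have c0 := h0 n
  have c1 := h1 n
  have c2 := h2 n
  have c3 := one_add_natCast_ne_zero n
  have c4 : 2 + k + (n : ℂ) ≠ 0 := by
    have := h2 (n + 1); push_cast at this; intro h; exact this (by linear_combination h)
  have c5 : 3 / 2 + k / 2 + (n : ℂ) ≠ 0 := by
    have := h0 (n + 1); push_cast at this; intro h; exact this (by linear_combination h)
  rw [shiftFactor, coeffC, coeffC, e1, e7, e8, show 1 + (k + 1) / 2 = 1 / 2 + k / 2 + 1 by ring,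
    show 1 + (k + 1) = 1 + k + 1 by ring, show 1 / 2 + (k + 1) = 1 / 2 + k + 1 by ring,
    show 1 / 6 + (k + 1) = 1 / 6 + k + 1 by ring, show 5 / 6 + (k + 1) = 5 / 6 + k + 1 by ring,
    f5, f6]
  calc _ = (-(27 / 32) * (rising (1 / 2 - k) n * ((1 / 2 + k) * rising (1 / 2 + k + 1) (n + 1)) *
        ((1 / 6 + k) * rising (1 / 6 + k + 1) (n + 1)) *
        ((5 / 6 + k) * rising (5 / 6 + k + 1) (n + 1)))) / ((1 + k) ^ 2 *
          (rising (1 + k / 2) n * (1 + k / 2 + n) *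
          (rising (1 / 2 + k / 2) n * (1 / 2 + k / 2 + n) * (1 / 2 + k / 2 + 1 + n) /
            (1 / 2 + k / 2)) *
          (rising (1 + k) n * (1 + k + n) * (1 + k + 1 + n) / (1 + k)) *
          (rising 1 n * (1 + n)))) := by
        rw [div_mul_div_comm]; congr 1; ring
    _ = _ := by
        rw [e2, e3, e4, show (1 / 2 + k / 2 + 1 + n : ℂ) = 3 / 2 + k / 2 + n by ring,
          show (1 + k + 1 + n : ℂ) = 2 + k + n by ring,
          show (1 / 2 + k + 1 + n : ℂ) = 3 / 2 + k + n by ring,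
          show (1 / 6 + k + 1 + n : ℂ) = 7 / 6 + k + n by ring,
          show (5 / 6 + k + 1 + n : ℂ) = 11 / 6 + k + n by ring,
          show (1 / 2 + k / 2 : ℂ) = (1 + k) / 2 by ring]
        rw [show (1 / 2 + k / 2 : ℂ) = (1 + k) / 2 by ring] at b0 c0
        exact shift_algebra a1 b0 b1 b2 b3 c0 c1 c2 c3 c4 c5

/-- The summand of the series. -/
noncomputable def term (n : ℕ) (k : ℂ) : ℂ :=
  (-27 / 512 : ℂ) ^ n * coeffC n k * ratR n k

/-- The telescoping certificate, normalised so that it has no singularity at half-odd `k`. -/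
noncomputable def cert (n : ℕ) (k : ℂ) : ℂ :=
  (-27 / 512 : ℂ) ^ (n + 1) * coeffC n k *
    ((1 / 2 + k + n) * (1 / 6 + k + n) * (5 / 6 + k + n) * (416 * (n + 1) + 160 * k - 16) /
      (2 * ((1 / 2 + k / 2 + n) * (1 + k / 2 + n) * (1 + k + n))))

theorem shiftFactor_mul_term_zero {k : ℂ} (hk : ∀ m : ℕ, k ≠ -(m + 1)) :
    shiftFactor k * term 0 (k + 1) - term 0 k = cert 0 k := by
  have h0 : (1 + k : ℂ) ≠ 0 := by simpa using one_add_add_natCast_ne_zero hk 0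
  have h1 : (2 + k : ℂ) ≠ 0 := fun h => hk 1 (by push_cast; linear_combination h)
  have h2 : (k + 1 + 1 : ℂ) ≠ 0 := by rwa [show k + 1 + 1 = 2 + k by ring]
  have h3 : (k + 1 : ℂ) ≠ 0 := by rwa [add_comm]
  have h4 : (1 / 2 + k / 2 : ℂ) ≠ 0 := by simpa using half_add_half_add_natCast_ne_zero hk 0
  have h5 : (1 + k / 2 : ℂ) ≠ 0 := by simpa using one_add_half_add_natCast_ne_zero hk 0
  simp only [term, cert, coeffC_zero, ratR, shiftFactor, Nat.cast_zero]
  rw [show (1 / 2 + k / 2 + 0: ℂ) = (1 + k) / 2 by ring, show (1 + k / 2 +0: ℂ) = (2 + k) / 2 by ring,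
    show (2 * 0 + (k + 1) + 1 : ℂ) = 2 + k by ring, show (2 * 0 + k + 1 : ℂ) = 1 + k by ring]
  simp only [add_zero]
  field_simp
  ring

theorem shiftFactor_mul_term_succ {k : ℂ} (hk : ∀ m : ℕ, k ≠ -(m + 1)) (n : ℕ) :
    shiftFactor k * term (n + 1) (k + 1) - term (n + 1) k = cert (n + 1) k - cert n k := by
  have h0 := half_add_half_add_natCast_ne_zero hk
  have h1 := one_add_half_add_natCast_ne_zero hk
  have h2 := one_add_add_natCast_ne_zero hk
  have c0 : 1 + k + 2 * (n : ℂ) ≠ 0 := fun h => h0 n (by linear_combination h / 2)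
  have c1 : 2 + k + 2 * (n : ℂ) ≠ 0 := fun h => h1 n (by linear_combination h / 2)
  have c2 := h2 n
  have c3 := one_add_natCast_ne_zero n
  have c4 : 2 + k + (n : ℂ) ≠ 0 := by
    have := h2 (n + 1); push_cast at this; intro h; exact this (by linear_combination h)
  have c5 : 3 + k + 2 * (n : ℂ) ≠ 0 := by
    have := h0 (n + 1); push_cast at this; intro h; exact this (by linear_combination h / 2)
  have c6 : 4 + k + 2 * (n : ℂ) ≠ 0 := by
    have := h1 (n + 1); push_cast at this; intro h; exact this (by linear_combination h / 2)
  have e : shiftFactor k * term (n + 1) (k + 1) = (-27 / 512 : ℂ) ^ (n + 1) *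
      (shiftFactor k * coeffC (n + 1) (k + 1)) * ratR (n + 1) (k + 1) := by
    rw [term]; ring
  rw [e, shiftFactor_mul_coeffC hk, term, cert, cert, coeffC_succ]
  generalize coeffC n k = C
  rw [pow_succ _ (n + 1)]
  generalize (-27 / 512 : ℂ) ^ (n + 1) = Z
  simp only [ratR]
  push_cast
  generalize (n : ℂ) = N at *
  rw [show (1 / 2 + k / 2 + N : ℂ) = (1 + k + 2 * N) / 2 by ring,
    show (1 + k / 2 + N : ℂ) = (2 + k + 2 * N) / 2 by ring,
    show (3 / 2 + k / 2 + N : ℂ) = (3 + k + 2 * N) / 2 by ring,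
    show (1 / 2 + k / 2 + (N + 1) : ℂ) = (3 + k + 2 * N) / 2 by ring,
    show (1 + k / 2 + (N + 1) : ℂ) = (4 + k + 2 * N) / 2 by ring,
    show (2 * (N + 1) + (k + 1) + 1 : ℂ) = (4 + k + 2 * N) by ring,
    show (2 * (N + 1) + k + 1 : ℂ) = (3 + k + 2 * N) by ring,
    show (1 + k + (N + 1) : ℂ) = (2 + k + N) by ring]
  field_simp
  ring

/-! ### Absolute convergence and the functional equation of the sum. -/

/-- The summand of the series without its rational factor, weighted by `n + 1`. -/
noncomputable def weighted (n : ℕ) (k : ℂ) : ℂ :=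
  (n + 1) * ((-27 / 512 : ℂ) ^ n * coeffC n k)

theorem tendsto_add_div_add (a b : ℂ) :
    Tendsto (fun n : ℕ => (a + n) / (b + n)) atTop (𝓝 1) := by
  simpa using tendsto_add_mul_div_add_mul_atTop_nhds a b 1 (one_ne_zero (α := ℂ))

theorem weighted_succ (n : ℕ) (k : ℂ) :
    weighted (n + 1) k = weighted n k * (-27 / 512 * (((2 + n) / (1 + n)) *
      (((1 / 2 - k + n) / (1 / 2 + k / 2 + n)) * ((1 / 2 + k + n) / (1 + k / 2 + n)) *
        ((1 / 6 + k + n) / (1 + k + n)) * ((5 / 6 + k + n) / (1 + n))))) := by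
  have := one_add_natCast_ne_zero n
  have h : weighted n k = (1 + n) * ((-27 / 512 : ℂ) ^ n * coeffC n k) := by
    rw [weighted]; ring
  rw [h, weighted, coeffC_succ, pow_succ]
  simp only [div_mul_div_comm]
  push_cast
  rw [show (n : ℂ) + 1 + 1 = 2 + n by ring]
  generalize (1 / 2 + k / 2 + n) * (1 + k / 2 + n) * (1 + k + n) = d
  generalize (1 / 2 - k + n) * (1 / 2 + k + n) * (1 / 6 + k + n) * (5 / 6 + k + n) = c
  generalize (-27 / 512 : ℂ) ^ n = z
  generalize 1 + (n : ℂ) = s at *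
  generalize 2 + (n : ℂ) = t
  rcases eq_or_ne d 0 with rfl | h0
  · simp
  · field_simp

/-- Ratio test: the quotient tends to `-27/512`. No condition on `k` is needed, since a vanishing
denominator makes all later coefficients 0. The weight `n + 1` leaves room for the linear growth of
`ratR` and for the certificate. -/
theorem summable_weighted (k : ℂ) : Summable fun n => weighted n k := by
  have lim : Tendsto (fun n : ℕ => ‖-27 / 512 * (((2 + (n : ℂ)) / (1 + n)) *
      (((1 / 2 - k + n) / (1 / 2 + k / 2 + n)) * ((1 / 2 + k + n) / (1 + k / 2 + n)) *
        ((1 / 6 + k + n) / (1 + k + n)) * ((5 / 6 + k + n) / (1 + n))))‖) atTop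
      (𝓝 ‖(-27 / 512 : ℂ) * (1 * (1 * 1 * 1 * 1))‖) := by
    refine (Tendsto.const_mul _ ((tendsto_add_div_add 2 1).mul ?_)).norm
    exact (((tendsto_add_div_add _ _).mul (tendsto_add_div_add _ _)).mul
      (tendsto_add_div_add _ _)).mul (tendsto_add_div_add _ _)
  refine summable_of_ratio_norm_eventually_le (r := 1 / 2) (by norm_num) ?_
  filter_upwards [lim.eventually_lt_const (u := 1 / 2) (by norm_num)] with n hn
  rw [weighted_succ, norm_mul, mul_comm]
  exact mul_le_mul_of_nonneg_right hn.le (norm_nonneg _)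

theorem tendsto_ratR_div (k : ℂ) :
    Tendsto (fun n : ℕ => ratR n k / (n + 1)) atTop (𝓝 154) := by
  have h : Tendsto (fun n : ℕ => 154 * ((15 / 154 + (n : ℂ)) / (1 + n)) *
      ((1 / 2 + n) / ((k + 1) / 2 + n)) + k / 2 * (352 * (((27 * k + 27) / 88 + n) / (1 + n)) *
        ((1 : ℂ) / ((k + 1) / 2 + n)))) atTop (𝓝 (154 * 1 * 1 + k / 2 * (352 * 1 * 0))) := by
    have z : Tendsto (fun n : ℕ => (1 : ℂ) / ((k + 1) / 2 + n)) atTop (𝓝 0) := by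
      simpa using tendsto_add_mul_div_add_mul_atTop_nhds (1 : ℂ) ((k + 1) / 2) 0
        (one_ne_zero (α := ℂ))
    exact (((tendsto_add_div_add _ _).const_mul _).mul (tendsto_add_div_add _ _)).add
      ((((tendsto_add_div_add _ _).const_mul _).mul z).const_mul _)
  norm_num at h
  refine h.congr fun n => ?_
  have := one_add_natCast_ne_zero n
  have e : 2 * (n : ℂ) + k + 1 = 2 * ((k + 1) / 2 + n) := by ring
  rw [ratR, e]
  rcases eq_or_ne ((k + 1) / 2 + (n : ℂ)) 0 with h0 | h0
  · simp [h0]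
  · generalize (k + 1) / 2 + (n : ℂ) = d at *
    rw [add_comm (n : ℂ) 1]
    field_simp
    ring

theorem summable_norm_term (k : ℂ) : Summable fun n => ‖term n k‖ := by
  have h := (summable_weighted k).norm.mul_tendsto_const
    (by rw [Nat.cofinite_eq_atTop]; exact tendsto_ratR_div k)
  refine h.norm.congr fun n => ?_
  have : (n : ℂ) + 1 ≠ 0 := Nat.cast_add_one_ne_zero n
  rw [weighted, term]
  congr 1
  field_simp

theorem summable_term (k : ℂ) : Summable fun n => term n k :=
  (summable_norm_term k).of_norm

theorem tendsto_cert (k : ℂ) : Tendsto (fun n => cert n k) atTop (𝓝 0) := by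
  have w := (summable_weighted k).tendsto_atTop_zero
  have h : Tendsto (fun n : ℕ => weighted n k * (-27 / 512 / 2 * 416) *
      (((1 / 2 + k + n) / (1 / 2 + k / 2 + n)) * ((1 / 6 + k + n) / (1 + k / 2 + n)) *
        ((5 / 6 + k + n) / (1 + k + n)) * (((160 * k + 400) / 416 + n) / (1 + n)))) atTop
      (𝓝 (0 * (-27 / 512 / 2 * 416) * (1 * 1 * 1 * 1))) :=
    (w.mul_const _).mul ((((tendsto_add_div_add _ _).mul (tendsto_add_div_add _ _)).mul
      (tendsto_add_div_add _ _)).mul (tendsto_add_div_add _ _))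
  rw [zero_mul, zero_mul] at h
  refine h.congr fun n => ?_
  have : 1 + (n : ℂ) ≠ 0 := one_add_natCast_ne_zero n
  rw [cert, weighted, pow_succ]
  simp only [div_mul_div_comm]
  rw [show 416 * ((n : ℂ) + 1) + 160 * k - 16 = 416 * ((160 * k + 400) / 416 + n) by ring,
    add_comm (n : ℂ) 1]
  generalize (1 / 2 + k / 2 + n) * (1 + k / 2 + n) * (1 + k + n) = d
  generalize (1 / 2 + k + n) * (1 / 6 + k + n) * (5 / 6 + k + n) = c
  generalize (160 * k + 400) / 416 + n = b
  generalize (-27 / 512 : ℂ) ^ n = z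
  generalize 1 + (n : ℂ) = s at *
  rcases eq_or_ne d 0 with rfl | h0
  · simp
  · field_simp

theorem sum_shiftFactor_mul_term {k : ℂ} (hk : ∀ m : ℕ, k ≠ -(m + 1)) (N : ℕ) :
    ∑ n ∈ Finset.range (N + 1), (shiftFactor k * term n (k + 1) - term n k) = cert N k := by
  induction N with
  | zero => simp [shiftFactor_mul_term_zero hk]
  | succ N ih => rw [Finset.sum_range_succ, ih, shiftFactor_mul_term_succ hk]; ring

/-- The partial sums of the difference telescope to `cert N k`, which tends to 0. -/
theorem shiftFactor_mul_tsum_term {k : ℂ} (hk : ∀ m : ℕ, k ≠ -(m + 1)) :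
    shiftFactor k * ∑' n, term n (k + 1) = ∑' n, term n k := by
  have h := (((summable_term (k + 1)).hasSum.mul_left (shiftFactor k)).sub
    (summable_term k).hasSum).tendsto_sum_nat
  have h' := (tendsto_add_atTop_iff_nat 1).mpr h
  simp only [sum_shiftFactor_mul_term hk] at h'
  exact sub_eq_zero.mp (tendsto_nhds_unique h' (tendsto_cert k))

/-! ### Growth and holomorphy of the sum on the right half-plane. -/

theorem ne_neg_of_re_nonneg {k : ℂ} (hre : 0 ≤ k.re) (m : ℕ) : k ≠ -(m + 1) := by
  rintro rfl
  simp at hre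
  have : (0 : ℝ) ≤ m := m.cast_nonneg
  linarith

theorem norm_add_ofReal_le_norm_add_ofReal {k : ℂ} {a b : ℝ} (hre : 0 ≤ k.re) (ha : 0 ≤ a)
    (hab : a ≤ b) : ‖k + a‖ ≤ ‖k + b‖ := by
  rw [← sq_le_sq₀ (norm_nonneg _) (norm_nonneg _), Complex.sq_norm, Complex.sq_norm,
    Complex.normSq_apply, Complex.normSq_apply]
  simp only [Complex.add_re, Complex.ofReal_re, Complex.add_im, Complex.ofReal_im, add_zero]
  nlinarith

theorem norm_div_le_of_re_nonneg {k : ℂ} {a b : ℝ} (hre : 0 ≤ k.re) (ha : 0 ≤ a) (hab : a ≤ b)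
    {u v : ℂ} {c : ℝ} (hc : 0 ≤ c) (hu : u = k + a) (hv : c * v = k + b) : ‖u / v‖ ≤ c := by
  rw [norm_div]
  refine div_le_of_le_mul₀ (norm_nonneg _) hc ?_
  have : c * ‖v‖ = ‖k + b‖ := by
    rw [← hv, norm_mul, Complex.norm_real, Real.norm_of_nonneg hc]
  rw [this, hu]
  exact norm_add_ofReal_le_norm_add_ofReal hre ha hab

section Bounds

variable {k : ℂ} {m : ℕ} (hre : 0 ≤ k.re) (hm : ‖k‖ ≤ m)
include hre hm

/-- In the ratio of consecutive coefficients, three numerator factors are paired with denominators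
so that the quotients have norms at most 2, 1 and 2. The remaining factor is at most `(n + 1 + m) /
(n + 1)`, the ratio of consecutive binomial coefficients. -/
theorem norm_coeffC_le (n : ℕ) : ‖coeffC n k‖ ≤ 4 ^ n * (n + m).choose m := by
  induction n with
  | zero => simp [coeffC_zero]
  | succ n ih =>
    have e : coeffC (n + 1) k = coeffC n k * (((1 / 2 + k + n) / (1 / 2 + k / 2 + n)) *
        ((1 / 6 + k + n) / (1 + k + n)) * ((5 / 6 + k + n) / (1 + k / 2 + n)) *
        ((1 / 2 - k + n) / (1 + n))) := by
      rw [coeffC_succ]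
      simp only [div_mul_div_comm]
      congr 2 <;> ring
    have hn : (0 : ℝ) ≤ n := n.cast_nonneg
    have h1 : ‖(1 / 2 + k + n) / (1 / 2 + k / 2 + n)‖ ≤ 2 :=
      norm_div_le_of_re_nonneg (a := 1 / 2 + n) (b := 1 + 2 * n) hre (by positivity) (by linarith)
        (by norm_num) (by push_cast; ring) (by push_cast; ring)
    have h2 : ‖(1 / 6 + k + n) / (1 + k + n)‖ ≤ 1 :=
      norm_div_le_of_re_nonneg (a := 1 / 6 + n) (b := 1 + n) hre (by positivity) (by linarith)
        (by norm_num) (by push_cast; ring) (by push_cast; ring)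
    have h3 : ‖(5 / 6 + k + n) / (1 + k / 2 + n)‖ ≤ 2 :=
      norm_div_le_of_re_nonneg (a := 5 / 6 + n) (b := 2 + 2 * n) hre (by positivity) (by linarith)
        (by norm_num) (by push_cast; ring) (by push_cast; ring)
    have hn1 : ‖(1 + n : ℂ)‖ = n + 1 := by
      rw [add_comm]; exact_mod_cast Complex.norm_natCast (n + 1)
    have h4 : ‖(1 / 2 - k + n) / (1 + n)‖ ≤ (n + 1 + m) / (n + 1) := by
      rw [norm_div, hn1]
      gcongr
      calc ‖1 / 2 - k + (n : ℂ)‖ ≤ ‖(1 / 2 : ℂ)‖ + ‖k‖ + ‖(n : ℂ)‖ :=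
            (norm_add_le _ _).trans (by gcongr; exact norm_sub_le _ _)
        _ ≤ 1 + m + n := by
            rw [Complex.norm_natCast]
            gcongr
            norm_num
        _ = n + 1 + m := by ring
    have hc : ((n + 1 + m).choose m : ℝ) = (n + m).choose m * ((n + 1 + m) / (n + 1)) := by
      have := Nat.choose_mul_succ_eq (n + m) m
      rw [show n + m + 1 - m = n + 1 by omega, show n + m + 1 = n + 1 + m by ring] at this
      have t : ((n + m).choose m : ℝ) * (n + 1 + m) = (n + 1 + m).choose m * (n + 1) := by
        exact_mod_cast this
      rw [mul_div_assoc', t]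
      field_simp
    rw [e, norm_mul]
    calc ‖coeffC n k‖ * _ ≤ (4 ^ n * (n + m).choose m) * (2 * 1 * 2 * ((n + 1 + m) / (n + 1))) := by
          gcongr
          rw [norm_mul, norm_mul, norm_mul]
          gcongr
      _ = _ := by rw [hc]; ring

theorem norm_ratR_le (n : ℕ) : ‖ratR n k‖ ≤ 600 * (n + m + 1) := by
  have hn : (0 : ℝ) ≤ n := n.cast_nonneg
  have hd : 2 * (n : ℂ) + k + 1 ≠ 0 :=
    two_mul_natCast_add_add_one_ne_zero (ne_neg_of_re_nonneg hre) n
  have h1 : ‖(2 * n + 1 : ℂ) / (2 * n + k + 1)‖ ≤ 1 := by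
    rw [norm_div]
    refine div_le_one_of_le₀ ?_ (norm_nonneg _)
    have e : ‖(2 * n + 1 : ℂ)‖ = 2 * n + 1 := by exact_mod_cast Complex.norm_natCast (2 * n + 1)
    rw [e]
    refine le_trans ?_ (Complex.re_le_norm _)
    simp
    linarith
  have h2 : ‖k / (2 * n + k + 1)‖ ≤ 1 :=
    norm_div_le_of_re_nonneg (a := 0) (b := 2 * n + 1) hre le_rfl (by positivity)
      (by norm_num) (by simp) (by push_cast; ring)
  have e : ratR n k = (154 * n + 15) * ((2 * n + 1) / (2 * n + k + 1)) +
      k / (2 * n + k + 1) * (352 * n + 108 * k + 108) := by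
    rw [ratR]; field_simp
  have e1 : ‖(154 * n + 15 : ℂ)‖ = 154 * n + 15 := by
    exact_mod_cast Complex.norm_natCast (154 * n + 15)
  have e2 : ‖(352 * n + 108 : ℂ)‖ = 352 * n + 108 := by
    exact_mod_cast Complex.norm_natCast (352 * n + 108)
  have h3 : ‖(352 * n + 108 * k + 108 : ℂ)‖ ≤ 352 * n + 108 + 108 * m := by
    rw [show (352 * n + 108 * k + 108 : ℂ) = (352 * n + 108) + 108 * k by ring]
    refine (norm_add_le _ _).trans ?_
    rw [e2, norm_mul, Complex.norm_ofNat]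
    gcongr
  calc ‖ratR n k‖ ≤ (154 * n + 15) * 1 + 1 * (352 * n + 108 + 108 * m) := by
        rw [e]
        refine (norm_add_le _ _).trans ?_
        rw [norm_mul, norm_mul, e1]
        gcongr
    _ ≤ _ := by
        have : (0 : ℝ) ≤ m := m.cast_nonneg
        linarith

theorem norm_term_le (n : ℕ) : ‖term n k‖ ≤
    600 * (m + 1) * ((n + (m + 1)).choose (m + 1) * (27 / 128 : ℝ) ^ n) := by
  have hc : ((n + (m + 1)).choose (m + 1) : ℝ) * (m + 1) = (n + m + 1) * (n + m).choose m := by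
    have := Nat.add_one_mul_choose_eq (n + m) m
    exact_mod_cast this.symm
  have e : ‖(-27 / 512 : ℂ)‖ = 27 / 512 := by norm_num
  rw [term, norm_mul, norm_mul, norm_pow, e]
  calc _ ≤ (27 / 512 : ℝ) ^ n * (4 ^ n * (n + m).choose m) * (600 * (n + m + 1)) := by
        gcongr
        · exact norm_coeffC_le hre hm n
        · exact norm_ratR_le hre hm n
    _ = 600 * ((n + m + 1) * (n + m).choose m) * (27 / 512 * 4 : ℝ) ^ n := by
        rw [mul_pow]; ring
    _ = _ := by rw [← hc]; norm_num; ring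

/-- The majorant is a negative binomial series of ratio `4 * 27/512 = 27/128`, and `1 / (1 - 27/128)
= 128/101`. -/
theorem norm_tsum_term_le : ‖∑' n, term n k‖ ≤ 600 * (m + 1) * (128 / 101 : ℝ) ^ (m + 2) := by
  have h := (hasSum_choose_mul_geometric_of_norm_lt_one (m + 1)
    (r := (27 / 128 : ℝ)) (by norm_num)).mul_left (600 * (m + 1) : ℝ)
  refine (tsum_of_norm_bounded h (norm_term_le hre hm)).trans_eq ?_
  rw [one_div, ← inv_pow]
  norm_num

end Bounds

theorem differentiable_rising (n : ℕ) : Differentiable ℂ fun x => rising x n :=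
  (ascPochhammer ℂ n).differentiable

theorem differentiableAt_term (n : ℕ) {k : ℂ} (hk : ∀ m : ℕ, k ≠ -(m + 1)) :
    DifferentiableAt ℂ (term n) k := by
  have r {f : ℂ → ℂ} (hf : DifferentiableAt ℂ f k) :
      DifferentiableAt ℂ (fun x => rising (f x) n) k :=
    ((differentiable_rising n) (f k)).comp k hf
  have d1 := rising_ne_zero (half_add_half_add_natCast_ne_zero hk) n
  have d2 := rising_ne_zero (one_add_half_add_natCast_ne_zero hk) n
  have d3 := rising_ne_zero (one_add_add_natCast_ne_zero hk) n
  have d4 := rising_ne_zero one_add_natCast_ne_zero n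
  have hC : DifferentiableAt ℂ (coeffC n) k := by
    refine DifferentiableAt.div ?_ ?_ (mul_ne_zero (mul_ne_zero (mul_ne_zero d1 d2) d3) d4)
    · exact (((r (by fun_prop)).mul (r (by fun_prop))).mul (r (by fun_prop))).mul
        (r (by fun_prop))
    · exact (((r (by fun_prop)).mul (r (by fun_prop))).mul (r (by fun_prop))).mul
        (r (by fun_prop))
  have hR : DifferentiableAt ℂ (ratR n) k :=
    DifferentiableAt.div (by fun_prop) (by fun_prop) (two_mul_natCast_add_add_one_ne_zero hk n)
  exact (hC.const_mul _).mul hR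

/-- Weierstrass test on the half-plane cut with a ball, where one `m` serves all points and the
majorant is uniform. -/
theorem differentiableAt_tsum_term {k : ℂ} (hk : 0 < k.re) :
    DifferentiableAt ℂ (fun x => ∑' n, term n x) k := by
  obtain ⟨m, hm⟩ := exists_nat_gt ‖k‖
  have hU : IsOpen ({x : ℂ | 0 < x.re} ∩ Metric.ball 0 m) :=
    (isOpen_lt continuous_const Complex.continuous_re).inter Metric.isOpen_ball
  have hs := (hasSum_choose_mul_geometric_of_norm_lt_one (m + 1)
    (r := (27 / 128 : ℝ)) (by norm_num)).summable.mul_left (600 * (m + 1) : ℝ)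
  refine (Complex.differentiableOn_tsum_of_summable_norm hs (fun n x hx => ?_) hU
    fun n x hx => ?_).differentiableAt (hU.mem_nhds ⟨hk, by simpa using hm⟩)
  · exact (differentiableAt_term n (ne_neg_of_re_nonneg (le_of_lt hx.1))).differentiableWithinAt
  · exact norm_term_le (le_of_lt hx.1) (le_of_lt (mem_ball_zero_iff.mp hx.2)) n

/-! ### Periodic functions of exponential type below `2π`. -/

theorem norm_cuspFunction_le {E : ℂ → ℂ} {C c : ℝ}
    (hb : ∀ z, ‖E z‖ ≤ C * Real.exp (c * |z.im|)) {w : ℂ} (hw : w ≠ 0) :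
    ‖cuspFunction 1 E w‖ ≤ C * Real.exp (c / (2 * Real.pi) * |Real.log ‖w‖|) := by
  rw [cuspFunction_eq_of_nonzero _ _ hw]
  refine (hb _).trans_eq ?_
  rw [im_invQParam, abs_mul, abs_div, abs_neg, abs_one, abs_of_pos Real.two_pi_pos]
  congr 2
  ring

/-- Near 0 the cusp function is `O(‖w‖ ^ (-c / 2π))` with `c / 2π < 1`, so `w * f w` tends to 0 and
the singularity is removable. -/
theorem differentiable_cuspFunction_of_norm_le {E : ℂ → ℂ} (hd : Differentiable ℂ E)
    (hp : Function.Periodic E 1) {C c : ℝ} (hc : c < 2 * Real.pi)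
    (hb : ∀ z, ‖E z‖ ≤ C * Real.exp (c * |z.im|)) :
    Differentiable ℂ (cuspFunction 1 E) := by
  set f := cuspFunction 1 E with hf
  have ha : c / (2 * Real.pi) < 1 := (div_lt_one Real.two_pi_pos).mpr hc
  have h1 : Tendsto (fun w : ℂ => w * f w) (𝓝[≠] 0) (𝓝 0) := by
    have hlog : Tendsto (fun w : ℂ => Real.log ‖w‖) (𝓝[≠] 0) atBot :=
      Real.tendsto_log_nhdsGT_zero.comp tendsto_norm_nhdsNE_zero
    have hlim : Tendsto (fun w : ℂ => C * Real.exp ((1 - c / (2 * Real.pi)) * Real.log ‖w‖))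
        (𝓝[≠] 0) (𝓝 (C * 0)) :=
      (Real.tendsto_exp_atBot.comp (hlog.const_mul_atBot (by linarith))).const_mul C
    rw [mul_zero] at hlim
    refine squeeze_zero_norm' ?_ hlim
    filter_upwards [self_mem_nhdsWithin, hlog.eventually_le_atBot 0] with w hw hl
    have hw' : 0 < ‖w‖ := norm_pos_iff.mpr hw
    have := norm_cuspFunction_le hb hw
    rw [norm_mul]
    calc ‖w‖ * ‖f w‖ ≤ Real.exp (Real.log ‖w‖) *
          (C * Real.exp (c / (2 * Real.pi) * |Real.log ‖w‖|)) := by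
          rw [Real.exp_log hw']; gcongr
      _ = C * (Real.exp (Real.log ‖w‖) * Real.exp (c / (2 * Real.pi) * |Real.log ‖w‖|)) := by ring
      _ = _ := by
          rw [← Real.exp_add, abs_of_nonpos hl]
          congr 2
          ring
  have ho : (fun z => f z - f 0) =o[𝓝[≠] 0] fun z => (z - 0)⁻¹ := by
    rw [Asymptotics.isLittleO_iff_tendsto' (by
      filter_upwards [self_mem_nhdsWithin] with w hw h
      simp_all)]
    have h2 : Tendsto (fun w : ℂ => w * f 0) (𝓝[≠] 0) (𝓝 0) := by
      have : Tendsto (fun w : ℂ => w * f 0) (𝓝 0) (𝓝 (0 * f 0)) := tendsto_id.mul_const _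
      rw [zero_mul] at this
      exact this.mono_left nhdsWithin_le_nhds
    have h3 := h1.sub h2
    rw [sub_zero] at h3
    refine h3.congr fun w => ?_
    rw [sub_zero, div_inv_eq_mul]
    ring
  have hdiff : DifferentiableOn ℂ f (Set.univ \ {0}) := fun w hw => by
    have hw0 : w ≠ 0 := by simpa using hw
    rw [← qParam_right_inv one_ne_zero hw0]
    exact (differentiableAt_cuspFunction one_ne_zero (by simpa using hp)
      (hd _)).differentiableWithinAt
  have := Complex.differentiableOn_update_limUnder_of_isLittleO univ_mem hdiff ho
  -- The cusp function takes its limit as value at 0, so filling the singularity changes nothing.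
  rw [← cuspFunction_zero_eq_limUnder_nhds_ne, Function.update_eq_self] at this
  exact differentiableOn_univ.mp this

/-- An entire function of period `1` and of exponential type less than `2π` is constant. -/
theorem eq_of_periodic_of_norm_le {E : ℂ → ℂ} (hd : Differentiable ℂ E)
    (hp : Function.Periodic E 1) {C c : ℝ} (hc : c < 2 * Real.pi)
    (hb : ∀ z, ‖E z‖ ≤ C * Real.exp (c * |z.im|)) (z w : ℂ) : E z = E w := by
  set f := cuspFunction 1 E with hf
  have ha : c / (2 * Real.pi) < 1 := (div_lt_one Real.two_pi_pos).mpr hc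
  have hfd : Differentiable ℂ f := differentiable_cuspFunction_of_norm_le hd hp hc hb
  have hds : Differentiable ℂ (dslope f 0) := by
    rw [← differentiableOn_univ] at hfd ⊢
    exact (Complex.differentiableOn_dslope univ_mem).mpr hfd
  -- At infinity `f` is `O(‖w‖ ^ (c / 2π))`, hence sublinear. The entire function `dslope f 0` then
  -- tends to 0, so it vanishes by Liouville.
  have h1 : Tendsto (fun w : ℂ => w⁻¹ * f w) (cocompact ℂ) (𝓝 0) := by
    have hlog : Tendsto (fun w : ℂ => Real.log ‖w‖) (cocompact ℂ) atTop :=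
      Real.tendsto_log_atTop.comp (tendsto_norm_cocompact_atTop (E := ℂ))
    have hlim : Tendsto (fun w : ℂ => C * Real.exp ((c / (2 * Real.pi) - 1) * Real.log ‖w‖))
        (cocompact ℂ) (𝓝 (C * 0)) :=
      (Real.tendsto_exp_atBot.comp (hlog.const_mul_atTop_of_neg (by linarith))).const_mul C
    rw [mul_zero] at hlim
    refine squeeze_zero_norm' ?_ hlim
    filter_upwards [(tendsto_norm_cocompact_atTop (E := ℂ)).eventually_gt_atTop 0,
      hlog.eventually_ge_atTop 0] with w hw hl
    have := norm_cuspFunction_le hb (norm_pos_iff.mp hw)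
    rw [norm_mul, norm_inv]
    calc ‖w‖⁻¹ * ‖f w‖ ≤ (Real.exp (Real.log ‖w‖))⁻¹ *
          (C * Real.exp (c / (2 * Real.pi) * |Real.log ‖w‖|)) := by
          rw [Real.exp_log hw]; gcongr
      _ = C * (Real.exp (-Real.log ‖w‖) * Real.exp (c / (2 * Real.pi) * |Real.log ‖w‖|)) := by
          rw [Real.exp_neg]; ring
      _ = _ := by
          rw [← Real.exp_add, abs_of_nonneg hl]
          congr 2
          ring
  have h2 : Tendsto (dslope f 0) (cocompact ℂ) (𝓝 0) := by
    have h3 := (tendsto_inv₀_cobounded (α := ℂ)).mul_const (f 0)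
    rw [Metric.cobounded_eq_cocompact] at h3
    replace h3 := h1.sub h3
    rw [zero_mul, sub_zero] at h3
    refine h3.congr' ?_
    filter_upwards [(tendsto_norm_cocompact_atTop (E := ℂ)).eventually_gt_atTop 0] with w hw
    rw [dslope_of_ne _ (norm_pos_iff.mp hw), slope_def_field, sub_zero]
    ring
  have h0 (w : ℂ) : f w = f 0 := by
    have e := hds.apply_eq_of_tendsto_cocompact w h2
    have := sub_smul_dslope f 0 w
    rw [e, smul_zero] at this
    exact (sub_eq_zero.mp this.symm)
  have hp' : Function.Periodic E ((1 : ℝ) : ℂ) := by simpa using hp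
  rw [← eq_cuspFunction one_ne_zero hp' z, ← eq_cuspFunction one_ne_zero hp' w, ← hf, h0, ← h0]

/-- Translating each point by an integer into the strip `1 ≤ re ≤ 2` extends `S` to an entire
periodic `E`. The jumps of the floor are harmless: near any point `E` agrees with one fixed
translate of `S`. -/
theorem eq_of_periodic_halfPlane {S : ℂ → ℂ} (hd : ∀ z : ℂ, 0 < z.re → DifferentiableAt ℂ S z)
    (hp : ∀ z : ℂ, 0 < z.re → S (z + 1) = S z) {C c : ℝ} (hc : c < 2 * Real.pi)
    (hb : ∀ z : ℂ, 1 ≤ z.re → z.re ≤ 2 → ‖S z‖ ≤ C * Real.exp (c * |z.im|))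
    {z w : ℂ} (hz : 0 < z.re) (hw : 0 < w.re) : S z = S w := by
  have hpn (z : ℂ) (hz : 0 < z.re) (n : ℕ) : S (z + n) = S z := by
    induction n with
    | zero => simp
    | succ n ih =>
      rw [Nat.cast_add_one, ← add_assoc, hp _ (by simp; positivity), ih]
  have hpz (z : ℂ) (n : ℤ) (hz : 0 < z.re) (hn : 0 < z.re + n) : S (z + n) = S z := by
    rcases Int.eq_nat_or_neg n with ⟨m, rfl | rfl⟩
    · exact_mod_cast hpn z hz m
    · have := hpn (z + ((-m : ℤ) : ℂ)) (by simpa using hn) m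
      rw [← this]
      congr 1
      push_cast
      ring
  let E : ℂ → ℂ := fun z => S (z + ((1 - ⌊z.re⌋ : ℤ) : ℂ))
  have hre (z : ℂ) : 1 ≤ (z + ((1 - ⌊z.re⌋ : ℤ) : ℂ)).re ∧
      (z + ((1 - ⌊z.re⌋ : ℤ) : ℂ)).re ≤ 2 := by
    have h1 := Int.floor_le z.re
    have h2 := Int.lt_floor_add_one z.re
    rw [Complex.add_re, Complex.intCast_re]
    push_cast
    constructor <;> linarith
  have hE (z : ℂ) (n : ℤ) (hn : 0 < z.re + n) : E z = S (z + n) := by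
    have := hpz (z + n) (1 - ⌊z.re⌋ - n) (by simpa using hn) (by
      have := (hre z).1
      rw [Complex.add_re, Complex.intCast_re] at this ⊢
      push_cast at this ⊢
      linarith)
    rw [← this]
    simp only [E]
    congr 1
    push_cast
    ring
  have hEd : Differentiable ℂ E := fun z => by
    obtain ⟨n, hn⟩ := exists_int_gt (-z.re)
    have hn' : 0 < z.re + n := by linarith
    have ev : E =ᶠ[𝓝 z] fun x => S (x + n) := by
      have : ∀ᶠ x : ℂ in 𝓝 z, 0 < x.re + n :=
        (Continuous.tendsto (by fun_prop : Continuous fun x : ℂ => x.re + n) z).eventually_const_lt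
          hn'
      filter_upwards [this] with x hx using hE x n hx
    refine DifferentiableAt.congr_of_eventuallyEq ?_ ev
    exact (hd (z + n) (by simpa using hn')).comp z (differentiableAt_id.add_const _)
  have hEp : Function.Periodic E 1 := fun z => by
    simp only [E]
    congr 1
    rw [Complex.add_re, Complex.one_re, Int.floor_add_one]
    push_cast
    ring
  have hEb (z : ℂ) : ‖E z‖ ≤ C * Real.exp (c * |z.im|) := by
    have := hb _ (hre z).1 (hre z).2
    rwa [Complex.add_im, Complex.intCast_im, add_zero] at this
  have e1 := hE z 0 (by simpa using hz)
  have e2 := hE w 0 (by simpa using hw)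
  rw [Int.cast_zero, add_zero] at e1 e2
  rw [← e1, ← e2]
  exact eq_of_periodic_of_norm_le hEd hEp hc hEb z w

/-! ### The weight: shift, boundedness and holomorphy. -/

/-- The factor `(27 / 32) ^ k * factorD k` common to the members of the WZ-pair. -/
noncomputable def weight (k : ℂ) : ℂ :=
  (27 / 32 : ℂ) ^ k * factorD k

theorem poch_add_one (x : ℂ) {k : ℂ} (h : x + k ≠ 0) :
    poch x (k + 1) = (x + k) * poch x k := by
  rw [poch, poch, ← add_assoc, Complex.Gamma_add_one _ h, mul_div_assoc]

theorem weight_add_one {k : ℂ} (h1 : 1 + k ≠ 0) (h2 : 1 / 6 + k ≠ 0) (h3 : 5 / 6 + k ≠ 0) :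
    weight (k + 1) = shiftFactor k * weight k := by
  rw [weight, weight, shiftFactor, factorD, factorD, poch_add_one _ h1, poch_add_one _ h2,
    poch_add_one _ h3, Complex.cpow_add _ _ (by norm_num), Complex.cpow_one, mul_pow]
  simp only [div_eq_mul_inv, mul_inv]
  ring

theorem Gamma_ne_zero_of_pos {x : ℝ} (hx : 0 < x) : Complex.Gamma x ≠ 0 :=
  Complex.Gamma_ne_zero_of_re_pos (by simpa using hx)

/-- On `(0, 1]` one has `|x ^ (u - 1)| ≤ 1` when `1 ≤ u.re`. The majorant is the integrand at `u =
1`, independent of `u`. -/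
theorem norm_betaIntegral_le {u v : ℂ} (hu : 1 ≤ u.re) (hv : 0 < v.re) :
    ‖Complex.betaIntegral u v‖ ≤
      ∫ x : ℝ in (0 : ℝ)..1, ‖(x : ℂ) ^ ((1 : ℂ) - 1) * (1 - (x : ℂ)) ^ (v - 1)‖ := by
  refine intervalIntegral.norm_integral_le_of_norm_le zero_le_one ?_
    (Complex.betaIntegral_convergent (by simp) hv).norm
  refine Eventually.of_forall fun x hx => ?_
  rw [norm_mul, sub_self, Complex.cpow_zero, one_mul]
  refine mul_le_of_le_one_left (norm_nonneg _) ?_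
  rw [Complex.norm_cpow_eq_rpow_re_of_pos hx.1]
  exact Real.rpow_le_one hx.1.le hx.2 (by simpa using hu)

/-- As `1/6 + 5/6 = 1`, both Beta integrals have `Gamma (1 + k)` as denominator. -/
theorem factorD_eq_betaIntegral {k : ℂ} (hk : 0 < k.re) :
    factorD k = Complex.betaIntegral (1 / 6 + k) (5 / 6) *
      Complex.betaIntegral (5 / 6 + k) (1 / 6) /
        (Complex.Gamma (1 / 6) * Complex.Gamma (5 / 6)) ^ 2 := by
  have g1 : Complex.Gamma (1 / 6) ≠ 0 := by
    simpa using Gamma_ne_zero_of_pos (x := 1 / 6) (by norm_num)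
  have g2 : Complex.Gamma (5 / 6) ≠ 0 := by
    simpa using Gamma_ne_zero_of_pos (x := 5 / 6) (by norm_num)
  have g3 : Complex.Gamma (1 + k) ≠ 0 :=
    Complex.Gamma_ne_zero_of_re_pos (by simp; linarith)
  have b1 := Complex.Gamma_mul_Gamma_eq_betaIntegral (s := 1 / 6 + k) (t := 5 / 6)
    (by simp; linarith) (by norm_num)
  have b2 := Complex.Gamma_mul_Gamma_eq_betaIntegral (s := 5 / 6 + k) (t := 1 / 6)
    (by simp; linarith) (by norm_num)
  rw [show 1 / 6 + k + 5 / 6 = 1 + k by ring] at b1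
  rw [show 5 / 6 + k + 1 / 6 = 1 + k by ring] at b2
  rw [factorD, poch, poch, poch, Complex.Gamma_one, div_one, div_mul_div_comm, div_div,
    div_eq_div_iff (by positivity) (by positivity)]
  linear_combination (Complex.Gamma (1 / 6) * Complex.Gamma (5 / 6)) *
    (Complex.Gamma (5 / 6 + k) * Complex.Gamma (1 / 6) * b1 +
      Complex.Gamma (1 + k) * Complex.betaIntegral (1 / 6 + k) (5 / 6) * b2)

theorem exists_norm_factorD_le : ∃ M : ℝ, ∀ k : ℂ, 1 ≤ k.re → ‖factorD k‖ ≤ M := by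
  refine ⟨(∫ x : ℝ in (0 : ℝ)..1, ‖(x : ℂ) ^ ((1 : ℂ) - 1) * (1 - (x : ℂ)) ^ (5 / 6 - 1 : ℂ)‖) *
    (∫ x : ℝ in (0 : ℝ)..1, ‖(x : ℂ) ^ ((1 : ℂ) - 1) * (1 - (x : ℂ)) ^ (1 / 6 - 1 : ℂ)‖) /
      ‖(Complex.Gamma (1 / 6) * Complex.Gamma (5 / 6)) ^ 2‖, fun k hk => ?_⟩
  rw [factorD_eq_betaIntegral (by linarith), norm_div, norm_mul]
  have b1 := norm_betaIntegral_le (u := 1 / 6 + k) (v := 5 / 6) (by simp; linarith) (by norm_num)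
  have b2 := norm_betaIntegral_le (u := 5 / 6 + k) (v := 1 / 6) (by simp; linarith) (by norm_num)
  exact div_le_div_of_nonneg_right
    (mul_le_mul b1 b2 (norm_nonneg _) ((norm_nonneg _).trans b1)) (norm_nonneg _)

theorem norm_weight_le {k : ℂ} (hk : 0 ≤ k.re) : ‖weight k‖ ≤ ‖factorD k‖ := by
  rw [weight, norm_mul]
  refine mul_le_of_le_one_left (norm_nonneg _) ?_
  have := Complex.norm_cpow_eq_rpow_re_of_pos (x := 27 / 32) (by norm_num) k
  push_cast at this
  rw [this]
  exact Real.rpow_le_one (by norm_num) (by norm_num) hk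

theorem differentiableAt_weight {k : ℂ} (hk : 0 < k.re) : DifferentiableAt ℂ weight k := by
  have g {x : ℂ} (hx : 0 ≤ x.re) : DifferentiableAt ℂ (poch x) k := by
    refine DifferentiableAt.div_const ?_ _
    refine (Complex.differentiableAt_Gamma (x + k) fun m h => ?_).comp k
      (differentiableAt_id.const_add x)
    have := congrArg Complex.re h
    simp at this
    have : (0 : ℝ) ≤ m := m.cast_nonneg
    linarith
  have h1 : poch 1 k ≠ 0 := by
    rw [poch, Complex.Gamma_one, div_one]
    exact Complex.Gamma_ne_zero_of_re_pos (by simp; linarith)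
  have hD : DifferentiableAt ℂ factorD k :=
    ((g (by norm_num)).mul (g (by norm_num))).div ((g (by simp)).pow 2) (pow_ne_zero 2 h1)
  exact DifferentiableAt.mul (differentiableAt_id.const_cpow (Or.inl (by norm_num))) hD

theorem weight_ne_zero {k : ℂ} (hk : 0 < k.re) : weight k ≠ 0 := by
  have g {x : ℝ} (hx : 0 < x) : poch x k ≠ 0 :=
    div_ne_zero (Complex.Gamma_ne_zero_of_re_pos (by simp; linarith)) (Gamma_ne_zero_of_pos hx)
  have h1 := g (x := 1) one_pos
  have h2 := g (x := 1 / 6) (by norm_num)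
  have h3 := g (x := 5 / 6) (by norm_num)
  push_cast at h1 h2 h3
  refine mul_ne_zero ?_ (div_ne_zero (mul_ne_zero h2 h3) (pow_ne_zero 2 h1))
  simp

/-! ### The value at `k = 1/2` and the sum on the right half-plane. -/

theorem tsum_term_half : ∑' n, term n (1 / 2) = 64 := by
  rw [tsum_eq_single 0 fun n hn => ?_]
  · rw [term, coeffC_zero, ratR]; norm_num
  · obtain ⟨n, rfl⟩ := Nat.exists_eq_succ_of_ne_zero hn
    rw [term, coeffC, sub_self, Nat.succ_eq_add_one, rising_succ_left 0]
    simp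

/-- The Gamma values group into the reflection products at `1/3` and `1/6`, together with `Gamma
(1/2) = √π`. -/
theorem factorD_half : factorD (1 / 2) = ((4 / (3 * √3 * Real.pi) : ℝ) : ℂ) := by
  have r1 := Complex.Gamma_mul_Gamma_one_sub (1 / 3)
  have r2 := Complex.Gamma_mul_Gamma_one_sub (1 / 6)
  have s1 : Complex.sin (Real.pi * (1 / 3)) = ((√3 / 2 : ℝ) : ℂ) := by
    rw [← Real.sin_pi_div_three, Complex.ofReal_sin]
    push_cast
    ring_nf
  have s2 : Complex.sin (Real.pi * (1 / 6)) = ((1 / 2 : ℝ) : ℂ) := by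
    rw [← Real.sin_pi_div_six, Complex.ofReal_sin]
    push_cast
    ring_nf
  rw [s1, show (1 : ℂ) - 1 / 3 = 2 / 3 by norm_num] at r1
  rw [s2, show (1 : ℂ) - 1 / 6 = 5 / 6 by norm_num] at r2
  have g1 : Complex.Gamma (5 / 6 + 1 / 2) = 1 / 3 * Complex.Gamma (1 / 3) := by
    rw [← Complex.Gamma_add_one _ (by norm_num)]; norm_num
  have g2 : Complex.Gamma (1 + 1 / 2) ^ 2 = (Real.pi : ℂ) / 4 := by
    rw [add_comm, Complex.Gamma_add_one _ (by norm_num), Complex.Gamma_one_half_eq, mul_pow,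
      ← Complex.cpow_nat_mul]
    norm_num
    ring
  have hpi : (Real.pi : ℂ) ≠ 0 := by exact_mod_cast Real.pi_ne_zero
  have h3 : ((√3 : ℝ) : ℂ) ≠ 0 := by
    exact_mod_cast (Real.sqrt_pos.mpr (by norm_num : (0 : ℝ) < 3)).ne'
  rw [factorD, poch, poch, poch, Complex.Gamma_one, div_one, g1, g2, div_mul_div_comm, r2,
    show (1 / 6 + 1 / 2 : ℂ) = 2 / 3 by norm_num, show Complex.Gamma (2 / 3) *
      (1 / 3 * Complex.Gamma (1 / 3)) = 1 / 3 * (Complex.Gamma (1 / 3) * Complex.Gamma (2 / 3)) by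
      ring, r1]
  push_cast
  field_simp

theorem weight_half_mul : weight (1 / 2) * 64 = 32 * ((√2 : ℝ) : ℂ) / (Real.pi : ℂ) := by
  have e : (27 / 32 : ℂ) ^ (1 / 2 : ℂ) = ((3 * √3 * √2 / 8 : ℝ) : ℂ) := by
    have h : (27 / 32 : ℝ) ^ (1 / 2 : ℝ) = 3 * √3 * √2 / 8 := by
      rw [← Real.sqrt_eq_rpow, Real.sqrt_eq_iff_mul_self_eq (by norm_num) (by positivity)]
      have h2 := Real.mul_self_sqrt (show (0 : ℝ) ≤ 2 by norm_num)
      have h3 := Real.mul_self_sqrt (show (0 : ℝ) ≤ 3 by norm_num)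
      linear_combination -(9 / 64) * (√3 * √3) * h2 - (9 / 32) * h3
    rw [← h, Complex.ofReal_cpow (by norm_num)]
    push_cast
    rfl
  rw [weight, e, factorD_half]
  norm_cast
  have := Real.pi_ne_zero
  field_simp
  norm_num

theorem weight_mul_tsum_term {k : ℂ} (hk : 0 < k.re) :
    weight k * ∑' n, term n k = 32 * ((√2 : ℝ) : ℂ) / (Real.pi : ℂ) := by
  rw [← weight_half_mul, ← tsum_term_half]
  obtain ⟨M, hM⟩ := exists_norm_factorD_le
  refine eq_of_periodic_halfPlane (S := fun k => weight k * ∑' n, term n k)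
    (C := M * (600 * Real.exp 8)) (c := 2)
    (fun z hz => (differentiableAt_weight hz).mul (differentiableAt_tsum_term hz))
    (fun z hz => ?_) (by linarith [Real.pi_gt_three]) (fun z h1 h2 => ?_) hk (by norm_num)
  · have ne {a : ℂ} (ha : 0 ≤ a.re) : a + z ≠ 0 := fun h => by
      have := congrArg Complex.re h
      simp at this
      linarith
    rw [weight_add_one (ne (by simp)) (ne (by norm_num)) (ne (by norm_num)),
      ← shiftFactor_mul_tsum_term (ne_neg_of_re_nonneg hz.le)]
    ring
  · have hm := Nat.le_ceil ‖z‖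
    have hm' := (Nat.ceil_lt_add_one (norm_nonneg z)).le
    generalize ⌈‖z‖⌉₊ = m at hm hm'
    have hz : ‖z‖ ≤ 2 + |z.im| := by
      refine (Complex.norm_le_abs_re_add_abs_im z).trans ?_
      rw [abs_of_nonneg (by linarith)]
      linarith
    have ht := norm_tsum_term_le (by linarith) hm
    have hw := (norm_weight_le (k := z) (by linarith)).trans (hM z h1)
    rw [norm_mul, mul_assoc]
    have hM0 : 0 ≤ M := (norm_nonneg _).trans hw
    gcongr
    -- Here `m` is the ceiling of `‖z‖`, so `m ≤ 3 + |z.im|` on the strip. With `m + 1 ≤ exp m` and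
    -- `128/101 ≤ e` the exponent is at most `2m + 2 ≤ 8 + 2|z.im|`, which gives type `2 < 2π`.
    calc ‖∑' n, term n z‖ ≤ 600 * (m + 1) * (128 / 101 : ℝ) ^ (m + 2) := ht
      _ ≤ 600 * Real.exp m * Real.exp 1 ^ (m + 2) := by
          gcongr
          · exact Real.add_one_le_exp _
          · linarith [Real.add_one_le_exp (1 : ℝ)]
      _ = 600 * Real.exp (m + (m + 2 : ℕ) * 1) := by
          rw [Real.exp_add, Real.exp_nat_mul, mul_assoc]
      _ ≤ 600 * Real.exp (8 + 2 * |z.im|) := by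
          refine mul_le_mul_of_nonneg_left (Real.exp_le_exp.mpr ?_) (by norm_num)
          push_cast
          linarith
      _ = _ := by rw [Real.exp_add, mul_assoc]

/-! ### Continuation to all `k` other than negative integers. -/

/-- The closed form of the series. -/
noncomputable def closedForm (k : ℂ) : ℂ :=
  32 * ((√2 : ℝ) : ℂ) / (Real.pi : ℂ) * (32 / 27 : ℂ) ^ k *
    (poch 1 k ^ 2 / (poch (1 / 6) k * poch (5 / 6) k))

theorem cpow_inv_weight (k : ℂ) : (32 / 27 : ℂ) ^ k = ((27 / 32 : ℂ) ^ k)⁻¹ := by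
  rw [← Complex.inv_cpow _ _ ?_]
  · norm_num
  · have : (27 / 32 : ℂ) = ((27 / 32 : ℝ) : ℂ) := by push_cast; rfl
    rw [this, Complex.arg_ofReal_of_nonneg (by norm_num)]
    exact Real.pi_ne_zero.symm

theorem closedForm_eq (k : ℂ) :
    closedForm k = 32 * ((√2 : ℝ) : ℂ) / (Real.pi : ℂ) / weight k := by
  rw [closedForm, weight, cpow_inv_weight, factorD]
  simp only [div_eq_mul_inv, mul_inv, inv_inv]
  ring

/-- Unconditional: `Complex.Gamma` is 0 at its poles, so its inverse there is 0, exactly the value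
of the entire function `1/Γ`. -/
theorem inv_poch (x k : ℂ) : (poch x k)⁻¹ = (x + k) * (poch x (k + 1))⁻¹ := by
  have := Complex.one_div_Gamma_eq_self_mul_one_div_Gamma_add_one (x + k)
  rw [poch, poch, inv_div, inv_div, ← add_assoc, div_eq_mul_inv, this]
  ring

theorem shiftFactor_mul_closedForm {k : ℂ} (hk : 1 + k ≠ 0) :
    shiftFactor k * closedForm (k + 1) = closedForm k := by
  have h (a b c d : ℂ) : a * (b / (c * d)) = a * (b * (c⁻¹ * d⁻¹)) := by
    rw [div_eq_mul_inv, mul_inv]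
  rw [closedForm, closedForm, h, h, inv_poch (1 / 6) k, inv_poch (5 / 6) k, poch_add_one 1 hk,
    shiftFactor, Complex.cpow_add _ _ (by norm_num), Complex.cpow_one]
  field_simp

/-- Both sides satisfy the same recursion expressing the value at `k` through that at `k + 1`. No
division by `shiftFactor k` occurs, so its zeros at `-1/6` and `-5/6` do no harm. -/
theorem tsum_term_eq {k : ℂ} (hk : ∀ m : ℕ, k ≠ -(m + 1)) : ∑' n, term n k = closedForm k := by
  obtain ⟨N, hN⟩ := exists_nat_gt (-k.re)
  induction N generalizing k with
  | zero =>
    have h : 0 < k.re := by simpa using hN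
    rw [closedForm_eq, eq_div_iff (weight_ne_zero h), mul_comm, weight_mul_tsum_term h]
  | succ N ih =>
    rw [← shiftFactor_mul_tsum_term hk, ih (ne_neg_of_add_one hk) (by
      push_cast at hN; simp; linarith), shiftFactor_mul_closedForm
      (by simpa using one_add_add_natCast_ne_zero hk 0)]

theorem hasSum_term {k : ℂ} (hk : ∀ m : ℕ, k ≠ -(m + 1)) :
    HasSum (fun n => term n k) (closedForm k) :=
  tsum_term_eq hk ▸ (summable_term k).hasSum

/-! ### The WZ pair and its hypergeometric quotients. -/

/-- The factors by which `coeffC n (k + 1)` and `coeffC n k` are proportional. -/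
theorem coeffC_add_one {k : ℂ} (hk : ∀ m : ℕ, k ≠ -(m + 1)) (n : ℕ) :
    ((n - 1 / 2 - k) * (1 / 2 + k) * (1 / 6 + k) * (5 / 6 + k) * (1 / 2 + k / 2 + n) *
      (1 + k + n)) * coeffC n (k + 1) =
    ((-1 / 2 - k) * (1 / 2 + k + n) * (1 / 6 + k + n) * (5 / 6 + k + n) * (1 / 2 + k / 2) *
      (1 + k)) * coeffC n k := by
  have shift (x : ℂ) : x * rising (x + 1) n = rising x n * (x + n) := by
    rw [← rising_succ_left, rising_succ]
  have e1 := shift (1 / 2 - (k + 1))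
  have e2 := shift (1 / 2 + k)
  have e3 := shift (1 / 6 + k)
  have e4 := shift (5 / 6 + k)
  have e5 := shift (1 / 2 + k / 2)
  have e6 := shift (1 + k)
  have h0 := half_add_half_add_natCast_ne_zero hk
  have h1 := one_add_half_add_natCast_ne_zero hk
  have h2 := one_add_add_natCast_ne_zero hk
  have h0' := half_add_half_add_natCast_ne_zero (ne_neg_of_add_one hk)
  have h1' := one_add_half_add_natCast_ne_zero (ne_neg_of_add_one hk)
  have h2' := one_add_add_natCast_ne_zero (ne_neg_of_add_one hk)
  have b0 := rising_ne_zero h0 n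
  have b1 := rising_ne_zero h1 n
  have b2 := rising_ne_zero h2 n
  have b3 := rising_ne_zero one_add_natCast_ne_zero n
  have b1' := rising_ne_zero h1' n
  have b2' := rising_ne_zero h2' n
  rw [show 1 / 2 - (k + 1) + 1 = 1 / 2 - k by ring] at e1
  rw [show 1 / 2 + k + 1 = 1 / 2 + (k + 1) by ring] at e2
  rw [show 1 / 6 + k + 1 = 1 / 6 + (k + 1) by ring] at e3
  rw [show 5 / 6 + k + 1 = 5 / 6 + (k + 1) by ring] at e4
  rw [show 1 / 2 + k / 2 + 1 = 1 + (k + 1) / 2 by ring] at e5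
  rw [show 1 + k + 1 = 1 + (k + 1) by ring] at e6
  rw [coeffC, coeffC, show 1 / 2 + (k + 1) / 2 = 1 + k / 2 by ring, mul_div_assoc',
    mul_div_assoc', div_eq_div_iff
      (mul_ne_zero (mul_ne_zero (mul_ne_zero b1 b1') b2') b3)
      (mul_ne_zero (mul_ne_zero (mul_ne_zero b0 b1) b2) b3)]
  rw [show (1 / 2 - (k + 1) : ℂ) = -1 / 2 - k by ring] at e1 ⊢
  calc _ = (rising (-1 / 2 - k) n * (-1 / 2 - k + n)) * ((1 / 2 + k) * rising (1 / 2 + (k + 1)) n) *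
        ((1 / 6 + k) * rising (1 / 6 + (k + 1)) n) * ((5 / 6 + k) * rising (5 / 6 + (k + 1)) n) *
        (rising (1 / 2 + k / 2) n * (1 / 2 + k / 2 + n)) * (rising (1 + k) n * (1 + k + n)) *
        (rising (1 + k / 2) n * rising 1 n) := by ring
    _ = _ := by
        rw [← e1, e2, e3, e4, ← e5, ← e6]
        ring

section Regular

variable {k : ℂ} (hk : k ∈ regularSet)
include hk

theorem ne_neg_of_mem_regularSet (m : ℕ) : k ≠ -(m + 1) := (hk.1 m).1

theorem sixth_add_ne_zero : 1 / 6 + k ≠ 0 := fun h =>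
  (hk.1 0).2.1 (by push_cast; linear_combination h)

theorem five_sixths_add_ne_zero : 5 / 6 + k ≠ 0 := fun h =>
  (hk.1 0).2.2 (by push_cast; linear_combination h)

theorem two_mul_intCast_sub_ne_zero (n : ℤ) : 2 * (n : ℂ) - 2 * k - 1 ≠ 0 := fun h =>
  hk.2 (n - 1) (by push_cast; linear_combination -(1 / 2) * h)

theorem weight_add_one_of_mem : weight (k + 1) = shiftFactor k * weight k :=
  weight_add_one (by simpa using one_add_add_natCast_ne_zero (ne_neg_of_mem_regularSet hk) 0)
    (sixth_add_ne_zero hk) (five_sixths_add_ne_zero hk)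

theorem mul_weight_add_one :
    32 * (1 + k) ^ 2 * weight (k + 1) = 27 * (1 / 6 + k) * (5 / 6 + k) * weight k := by
  have h : 1 + k ≠ 0 := by
    simpa using one_add_add_natCast_ne_zero (ne_neg_of_mem_regularSet hk) 0
  rw [weight_add_one_of_mem hk, shiftFactor]
  field_simp

end Regular

/-- The second member of the WZ-pair. -/
noncomputable def pairG (n : ℕ) (k : ℂ) : ℂ :=
  weight k * ((-27 / 512 : ℂ) ^ n * coeffC n k * ratR n k)

/-- The first member of the WZ-pair. -/
noncomputable def pairF (n : ℕ) (k : ℂ) : ℂ :=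
  weight k * ((-27 / 512 : ℂ) ^ n * coeffC n k *
    (n * (416 * n + 160 * k - 16) / (2 * n - 2 * k - 1)))

theorem pairF_zero (k : ℂ) : pairF 0 k = 0 := by
  simp [pairF]

theorem pairF_succ (n : ℕ) {k : ℂ} (hk : k ∈ regularSet) :
    pairF (n + 1) k = weight k * cert n k := by
  have h := two_mul_intCast_sub_ne_zero hk (n + 1)
  have h0 := half_add_half_add_natCast_ne_zero (ne_neg_of_mem_regularSet hk) n
  have h1 := one_add_half_add_natCast_ne_zero (ne_neg_of_mem_regularSet hk) n
  have h2 := one_add_add_natCast_ne_zero (ne_neg_of_mem_regularSet hk) n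
  have h3 := one_add_natCast_ne_zero n
  push_cast at h
  rw [pairF, cert, coeffC_succ]
  push_cast
  -- The new numerator factor of `coeffC (n + 1) k` is half the denominator of `pairF (n + 1) k`;
  -- cancelling it yields `cert`.
  rw [show (1 / 2 - k + n : ℂ) = (2 * (n + 1) - 2 * k - 1) / 2 by ring, add_comm (n : ℂ) 1] at *
  generalize (2 * (1 + (n : ℂ)) - 2 * k - 1) = a at *
  generalize 1 / 2 + k / 2 + (n : ℂ) = b at *
  generalize 1 + k / 2 + (n : ℂ) = c at *
  generalize 1 + k + (n : ℂ) = d at *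
  generalize 1 + (n : ℂ) = e at *
  generalize 416 * e + 160 * k - 16 = f at *
  field_simp

theorem pair_wz (n : ℕ) {k : ℂ} (hk : k ∈ regularSet) :
    pairF (n + 1) k - pairF n k = pairG n (k + 1) - pairG n k := by
  have hn := ne_neg_of_mem_regularSet hk
  have hG : pairG n (k + 1) - pairG n k =
      weight k * (shiftFactor k * term n (k + 1) - term n k) := by
    rw [pairG, pairG, weight_add_one_of_mem hk, term, term]
    ring
  rw [hG]
  cases n with
  | zero => rw [pairF_zero, pairF_succ 0 hk, shiftFactor_mul_term_zero hn, sub_zero]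
  | succ n => rw [pairF_succ _ hk, pairF_succ _ hk, shiftFactor_mul_term_succ hn]; ring

theorem tendsto_pairF {k : ℂ} (hk : k ∈ regularSet) :
    Tendsto (fun n => pairF n k) atTop (𝓝 0) := by
  rw [← tendsto_add_atTop_iff_nat 1]
  have h := (tendsto_cert k).const_mul (weight k)
  rw [mul_zero] at h
  exact h.congr fun n => (pairF_succ n hk).symm

theorem mul_coeffC_succ (n : ℕ) {k : ℂ} (hk : ∀ m : ℕ, k ≠ -(m + 1)) :
    ((1 / 2 + k / 2 + n) * (1 + k / 2 + n) * (1 + k + n) * (1 + n)) * coeffC (n + 1) k =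
      ((1 / 2 - k + n) * (1 / 2 + k + n) * (1 / 6 + k + n) * (5 / 6 + k + n)) * coeffC n k := by
  have h0 := half_add_half_add_natCast_ne_zero hk n
  have h1 := one_add_half_add_natCast_ne_zero hk n
  have h2 := one_add_add_natCast_ne_zero hk n
  have h3 := one_add_natCast_ne_zero n
  rw [coeffC_succ, mul_left_comm, mul_div_cancel₀ _ (by simp only [ne_eq, mul_eq_zero]; tauto),
    mul_comm]

theorem mul_ratR (n : ℕ) {k : ℂ} (hk : ∀ m : ℕ, k ≠ -(m + 1)) :
    (2 * n + k + 1) * ratR n k =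
      (154 * n + 15) * (2 * n + 1) + k * (352 * n + 108 * k + 108) :=
  mul_div_cancel₀ _ (two_mul_natCast_add_add_one_ne_zero hk n)

/-- `coeffC (n + 1) k / coeffC n k` has this denominator. -/
noncomputable def denomN : MvPolynomial (Fin 2) ℂ :=
  (C (1 / 2) + C (1 / 2) * X 1 + X 0) * (1 + C (1 / 2) * X 1 + X 0) * (1 + X 1 + X 0) * (1 + X 0)

/-- `coeffC (n + 1) k / coeffC n k` has this numerator. -/
noncomputable def numerN : MvPolynomial (Fin 2) ℂ :=
  (C (1 / 2) - X 1 + X 0) * (C (1 / 2) + X 1 + X 0) * (C (1 / 6) + X 1 + X 0) *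
    (C (5 / 6) + X 1 + X 0)

/-- `weight (k + 1) * coeffC n (k + 1) / (weight k * coeffC n k)` has this denominator. -/
noncomputable def denomK : MvPolynomial (Fin 2) ℂ :=
  (X 0 - C (1 / 2) - X 1) * (C (1 / 2) + X 1) * (C (1 / 6) + X 1) * (C (5 / 6) + X 1) *
    (C (1 / 2) + C (1 / 2) * X 1 + X 0) * (1 + X 1 + X 0) * (C 32 * (1 + X 1) ^ 2)

/-- `weight (k + 1) * coeffC n (k + 1) / (weight k * coeffC n k)` has this numerator. -/
noncomputable def numerK : MvPolynomial (Fin 2) ℂ :=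
  (-C (1 / 2) - X 1) * (C (1 / 2) + X 1 + X 0) * (C (1 / 6) + X 1 + X 0) *
    (C (5 / 6) + X 1 + X 0) * (C (1 / 2) + C (1 / 2) * X 1) * (1 + X 1) *
    (C 27 * (C (1 / 6) + X 1) * (C (5 / 6) + X 1))

theorem eval_denomN_mul (n : ℕ) {k : ℂ} (hk : ∀ m : ℕ, k ≠ -(m + 1)) :
    eval ![(n : ℂ), k] denomN * coeffC (n + 1) k = eval ![(n : ℂ), k] numerN * coeffC n k := by
  have := mul_coeffC_succ n hk
  simp only [denomN, numerN, map_mul, map_add, map_sub, map_one, eval_C, eval_X,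
    Matrix.cons_val_zero, Matrix.cons_val_one]
  linear_combination this

theorem eval_denomK_mul (n : ℕ) {k : ℂ} (hk : k ∈ regularSet) :
    eval ![(n : ℂ), k] denomK * (weight (k + 1) * coeffC n (k + 1)) =
      eval ![(n : ℂ), k] numerK * (weight k * coeffC n k) := by
  have h1 := coeffC_add_one (ne_neg_of_mem_regularSet hk) n
  have h2 := mul_weight_add_one hk
  simp only [denomK, numerK, map_mul, map_add, map_sub, map_one, map_neg, map_pow, eval_C, eval_X,
    Matrix.cons_val_zero, Matrix.cons_val_one]
  calc _ = (((n - 1 / 2 - k) * (1 / 2 + k) * (1 / 6 + k) * (5 / 6 + k) * (1 / 2 + k / 2 + n) *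
      (1 + k + n)) * coeffC n (k + 1)) * (32 * (1 + k) ^ 2 * weight (k + 1)) := by ring
    _ = _ := by rw [h1, h2]; ring

/-- The numerator of `ratR`. -/
noncomputable def numerR : MvPolynomial (Fin 2) ℂ :=
  (C 154 * X 0 + C 15) * (C 2 * X 0 + 1) + X 1 * (C 352 * X 0 + C 108 * X 1 + C 108)

theorem pairG_hypergeometric : IsHypergeometricOn regularSet pairG := by
  refine ⟨⟨C (-27 / 512) * numerN * (C 2 * X 0 + X 1 + 1) *
      ((C 154 * X 0 + C 169) * (C 2 * X 0 + 3) + X 1 * (C 352 * X 0 + C 108 * X 1 + C 460)),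
      denomN * (C 2 * X 0 + X 1 + 3) * numerR, ?_, fun n k hk => ?_⟩,
    ⟨numerK * (C 2 * X 0 + X 1 + 1) *
      ((C 154 * X 0 + C 15) * (C 2 * X 0 + 1) + (X 1 + 1) * (C 352 * X 0 + C 108 * X 1 + C 216)),
      denomK * (C 2 * X 0 + X 1 + 2) * numerR, ?_, fun n k hk => ?_⟩⟩
  · intro h
    -- The denominator is a nonzero polynomial because it does not vanish at `(1, 1)`.
    have := congrArg (eval ![(1 : ℂ), 1]) h
    simp [denomN, numerR] at this
    norm_num at this
  · have hn := ne_neg_of_mem_regularSet hk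
    have h1 := eval_denomN_mul n hn
    have h2 := mul_ratR n hn
    have h3 := mul_ratR (n + 1) hn
    push_cast at h3
    simp only [numerR, map_mul, map_add, map_one, map_ofNat, eval_C, eval_X, Matrix.cons_val_zero,
      Matrix.cons_val_one, pairG, pow_succ]
    rw [← h2]
    calc _ = weight k * ((-27 / 512) ^ n * (-27 / 512)) * (eval ![(n : ℂ), k] denomN *
          coeffC (n + 1) k) * ((2 * (n + 1) + k + 1) * ratR (n + 1) k) *
          ((2 * n + k + 1) * ratR n k) := by ring
      _ = _ := by rw [h1, h3]; ring
  · intro h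
    have := congrArg (eval ![(1 : ℂ), 1]) h
    simp [denomK, numerR] at this
    norm_num at this
  · have hn := ne_neg_of_mem_regularSet hk
    have h1 := eval_denomK_mul n hk
    have h2 := mul_ratR n hn
    have h3 := mul_ratR n (ne_neg_of_add_one hn)
    simp only [numerR, map_mul, map_add, map_one, map_ofNat, eval_X, Matrix.cons_val_zero,
      Matrix.cons_val_one, pairG]
    rw [← h2]
    calc _ = (-27 / 512) ^ n * (eval ![(n : ℂ), k] denomK * (weight (k + 1) *
          coeffC n (k + 1))) * ((2 * n + (k + 1) + 1) * ratR n (k + 1)) *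
          ((2 * n + k + 1) * ratR n k) := by ring
      _ = _ := by rw [h1, h3]; ring

theorem pairF_hypergeometric : IsHypergeometricOn regularSet pairF := by
  refine ⟨⟨C (-27 / 512) * numerN * (C 2 * X 0 - C 2 * X 1 - 1) *
      ((X 0 + 1) * (C 416 * X 0 + C 160 * X 1 + C 400)),
      denomN * (C 2 * X 0 - C 2 * X 1 + 1) * (X 0 * (C 416 * X 0 + C 160 * X 1 - C 16)),
      ?_, fun n k hk => ?_⟩,
    ⟨numerK * (C 2 * X 0 - C 2 * X 1 - 1) * (C 416 * X 0 + C 160 * X 1 + C 144),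
      denomK * (C 2 * X 0 - C 2 * X 1 - 3) * (C 416 * X 0 + C 160 * X 1 - C 16),
      ?_, fun n k hk => ?_⟩⟩
  · intro h
    have := congrArg (eval ![(1 : ℂ), 1]) h
    simp [denomN] at this
    norm_num at this
  · have h1 := eval_denomN_mul n (ne_neg_of_mem_regularSet hk)
    have h2 := two_mul_intCast_sub_ne_zero hk n
    have h3 := two_mul_intCast_sub_ne_zero hk (n + 1)
    push_cast at h2 h3
    have h2' := mul_div_cancel₀ ((n : ℂ) * (416 * n + 160 * k - 16)) h2
    have h3' := mul_div_cancel₀ ((n + 1 : ℂ) * (416 * (n + 1) + 160 * k - 16)) h3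
    simp only [map_mul, map_add, map_sub, map_one, map_ofNat, eval_C, eval_X,
      Matrix.cons_val_zero, Matrix.cons_val_one, pairF, pow_succ]
    push_cast
    generalize (n + 1 : ℂ) * (416 * (n + 1) + 160 * k - 16) / _ = r at *
    generalize (n : ℂ) * (416 * n + 160 * k - 16) / _ = s at *
    rw [← h2']
    calc _ = weight k * ((-27 / 512) ^ n * (-27 / 512)) * (eval ![(n : ℂ), k] denomN *
          coeffC (n + 1) k) * ((2 * (n + 1) - 2 * k - 1) * r) *
          ((2 * n - 2 * k - 1) * s) := by ring
      _ = _ := by rw [h1, h3']; ring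
  · intro h
    have := congrArg (eval ![(1 : ℂ), 1]) h
    simp [denomK] at this
    norm_num at this
  · have h1 := eval_denomK_mul n hk
    have h2 := two_mul_intCast_sub_ne_zero hk n
    have h3 := two_mul_intCast_sub_ne_zero hk (n - 1)
    push_cast at h2 h3
    have h3 : 2 * (n : ℂ) - 2 * (k + 1) - 1 ≠ 0 := by
      intro h; exact h3 (by linear_combination h)
    simp only [map_mul, map_add, map_sub, map_one, map_ofNat, eval_X,
      Matrix.cons_val_zero, Matrix.cons_val_one, pairF]
    -- The factor `n` is common to `pairF n k` and `pairF n (k + 1)`, so it is split off and does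
    -- not enter the quotient in `k`.
    rw [mul_div_assoc, mul_div_assoc]
    have h2' := mul_div_cancel₀ (416 * (n : ℂ) + 160 * k - 16) h2
    have h3' := mul_div_cancel₀ (416 * (n : ℂ) + 160 * (k + 1) - 16) h3
    generalize (416 * (n : ℂ) + 160 * (k + 1) - 16) / _ = r at *
    generalize (416 * (n : ℂ) + 160 * k - 16) / _ = s at *
    rw [← h2']
    calc _ = (-27 / 512) ^ n * n * (eval ![(n : ℂ), k] denomK * (weight (k + 1) *
          coeffC n (k + 1))) * ((2 * n - 2 * (k + 1) - 1) * r) *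
          ((2 * n - 2 * k - 1) * s) := by ring
      _ = _ := by rw [h1, h3']; ring

/-! ### The Ramanujan series at `k = 0`. -/

theorem hasSum_ramanujan :
    HasSum (fun n : ℕ => (-27 / 512 : ℂ) ^ n *
        (rising (1 / 2) n * rising (1 / 6) n * rising (5 / 6) n / rising 1 n ^ 3) *
          (15 + 154 * n))
      (32 * ((√2 : ℝ) : ℂ) / (Real.pi : ℂ)) := by
  have hk : ∀ m : ℕ, (0 : ℂ) ≠ -(m + 1) := ne_neg_of_re_nonneg le_rfl
  have g1 : Complex.Gamma (1 / 6) ≠ 0 := by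
    simpa using Gamma_ne_zero_of_pos (x := 1 / 6) (by norm_num)
  have g2 : Complex.Gamma (5 / 6) ≠ 0 := by
    simpa using Gamma_ne_zero_of_pos (x := 5 / 6) (by norm_num)
  have e : closedForm 0 = 32 * ((√2 : ℝ) : ℂ) / (Real.pi : ℂ) := by
    simp only [closedForm, poch, add_zero, Complex.cpow_zero, div_self g1, div_self g2,
      Complex.Gamma_one]
    norm_num
  rw [← e]
  refine (hasSum_term hk).congr_fun fun n => ?_
  have h0 := rising_ne_zero (half_add_half_add_natCast_ne_zero hk) n
  have h1 := rising_ne_zero one_add_natCast_ne_zero n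
  have hr : ratR n 0 = 15 + 154 * n := by
    rw [ratR, div_eq_iff (two_mul_natCast_add_add_one_ne_zero hk n)]
    ring
  simp only [zero_div, add_zero] at h0
  simp only [term, coeffC, hr, zero_div, add_zero, sub_zero]
  generalize rising (1 / 2) n = a at *
  generalize rising 1 n = b at *
  field_simp

end RamanujanWZ

theorem mainTheorem6 :
    -- the summation formula, for all complex `k` except the negative integers
    (∀ k : ℂ, (∀ m : ℕ, k ≠ -(m + 1)) →
      HasSum (fun n : ℕ => (-27 / 512 : ℂ) ^ n * RamanujanWZ.coeffC n k * RamanujanWZ.ratR n k)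
        (32 * ((√2 : ℝ) : ℂ) / (Real.pi : ℂ) * (32 / 27 : ℂ) ^ k *
          (RamanujanWZ.poch 1 k ^ 2 /
            (RamanujanWZ.poch (1 / 6) k * RamanujanWZ.poch (5 / 6) k)))) ∧
    -- it generalizes the Ramanujan series with `s = 1/6`, `z = -27/512`, `a = 15`, `b = 154`
    HasSum (fun n : ℕ => (-27 / 512 : ℂ) ^ n *
        (RamanujanWZ.rising (1 / 2) n * RamanujanWZ.rising (1 / 6) n *
          RamanujanWZ.rising (5 / 6) n / RamanujanWZ.rising 1 n ^ 3) * (15 + 154 * n))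
      (32 * ((√2 : ℝ) : ℂ) / (Real.pi : ℂ)) ∧
    -- it is WZ-demonstrable
    (∃ e₁₀ e₀₁ e₀₀ : ℚ, ∃ F G : ℕ → ℂ → ℂ,
      (∀ n k, G n k = (-27 / 512 : ℂ) ^ n * (27 / 32 : ℂ) ^ k *
        (RamanujanWZ.coeffC n k * RamanujanWZ.factorD k) * RamanujanWZ.ratR n k) ∧
      (∀ n k, F n k = (-27 / 512 : ℂ) ^ n * (27 / 32 : ℂ) ^ k *
        (RamanujanWZ.coeffC n k * RamanujanWZ.factorD k) *
          (n * (e₁₀ * n + e₀₁ * k + e₀₀) / (2 * n - 2 * k - 1))) ∧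
      RamanujanWZ.IsWZPairOn RamanujanWZ.regularSet F G ∧
      (∀ k ∈ RamanujanWZ.regularSet, F 0 k = 0) ∧
      (∀ k ∈ RamanujanWZ.regularSet,
        Filter.Tendsto (fun n => F n k) Filter.atTop (nhds 0))) := by
  -- The WZ equation at `n = 0` forces `e₀₁ = 160` and `e₁₀ + e₀₀ = 400`; the split `416`, `-16` is
  -- the one in `cert`.
  refine ⟨fun k hk => RamanujanWZ.hasSum_term hk, RamanujanWZ.hasSum_ramanujan, 416, 160, -16,
    RamanujanWZ.pairF, RamanujanWZ.pairG, fun n k => ?_, fun n k => ?_,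
    ⟨RamanujanWZ.pairF_hypergeometric, RamanujanWZ.pairG_hypergeometric,
      fun n k hk => RamanujanWZ.pair_wz n hk⟩,
    fun k _ => RamanujanWZ.pairF_zero k, fun k hk => RamanujanWZ.tendsto_pairF hk⟩
  · rw [RamanujanWZ.pairG, RamanujanWZ.weight]
    ring
  · rw [RamanujanWZ.pairF, RamanujanWZ.weight]
    push_cast
    ring
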